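/- Consider in $\mathbb R^n$ the nonlinear affine control system $\dot x_t=f(x_t,a_t)$, $f(x,a)=\sigma_0(x)+\sigma(x)a$, where $\sigma_0\in C^2(\mathbb R^n;\mathbb R^n)$, $\sigma=(\sigma_1,\dots,\sigma_m)\in C^2(\mathbb R^n;\mathbb R^{n\times m})$, and the controls $a_\cdot$ take values in the closed unit ball $B_1(0)\subset\mathbb R^m$. The class of admissible controls may be any class of measurable controls that contains the piecewise constant ones (with finitely many switches). Let $u\in C^3(\mathbb R^n)$ and $\bar x\in\mathbb R^n$, and let the target $\mathcal T$ coincide with $\{x:u(x)\le u(\bar x)\}$ in a neighborhood of $\bar x$. Let $$T(x)=\inf_{a_\cdot}\inf\{t\ge 0: x_t\in\mathcal T\},\qquad x_\cdot \text{ the trajectory with control } a_\cdot \text{ and } x_0=x,$$ be the minimum time function ($T(x)=+\infty$ if $\mathcal T$ cannot be reached from $x$). Write $[f,g]=Dg\,f-Df\,g$ and let $S(\bar x)$ be the $m\times m$ matrix with entries $S_{ij}(\bar x)=\nabla(\nabla u\cdot\sigma_i)\cdot\sigma_j(\bar x)$, $S^*(\bar x)$ its symmetric part, and $$K(\bar x)=\begin{pmatrix}S^*(\bar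 x)&{}^tS(\bar x)\\ S(\bar x)&S^*(\bar x)\end{pmatrix}.$$ Suppose that $\nabla u(\bar x)\neq0$, that $\nabla u\cdot\sigma_j(\bar x)=0$ for $j=0,1,\dots,m$, and that $\nabla(\nabla u\cdot\sigma_0)\cdot\sigma_0(\bar x)\le0$. Consider the two conditions: (a) there is $j\in\{1,\dots,m\}$ with $[\sigma_0,\sigma_j]\cdot\nabla u(\bar x)\ne0$, or $K(\bar x)$ is not positive semidefinite; (b) there is $a\in B_1(0)$ such that $\nabla\big(\nabla u\cdot(\sigma_0+\sigma a)\big)\cdot(\sigma_0+\sigma a)(\bar x)<0$. Let $s\in(1/3,1/2]$. If there are $C,r>0$ such that $$T(x)\le C|x-\bar x|^s\qquad\text{for all } x \text{ with } |x-\bar x|\le r,$$ then (a) or (b) holds. Conversely, if (a) or (b) holds, then such an estimate holds for this $s$; moreover it then holds with exponent $1/2$, and $\mathcal T$ is small time locally attainable at $\bar x$: for every $t>0$, $\bar x$ is an interior point of the set of points from which $\mathcal T$ can be reached in time less than $t$. -/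

import Mathlib

open scoped Topology ENNReal

noncomputable section

namespace AffineControl

/-- `ℝⁿ` with its Euclidean norm. -/
abbrev E (n : ℕ) : Type := EuclideanSpace ℝ (Fin n)

/-! ### Controls, trajectories, minimum time -/

/-- Measurable controls with values in the closed unit ball of `ℝᵐ`.
Controls are written as functions on `ℝ`; only their values at times `t ≥ 0` matter. -/
def IsMeasurableControl {m : ℕ} (a : ℝ → E m) : Prop :=
  Measurable a ∧ ∀ t, a t ∈ Metric.closedBall (0 : E m) 1

/-- Piecewise constant controls with values in the closed unit ball of `ℝᵐ`: there is a finite set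
of switching times, and the control takes equal values at any two times `s ≤ t` with no switching
time in `(s, t]`. -/
def IsPiecewiseConstantControl {m : ℕ} (a : ℝ → E m) : Prop :=
  (∃ F : Finset ℝ, ∀ s t : ℝ, s ≤ t → (∀ p ∈ F, p ∉ Set.Ioc s t) → a s = a t) ∧
    ∀ t, a t ∈ Metric.closedBall (0 : E m) 1

/-- `y` is a (Caratheodory) trajectory on `[0, t]` of `y' = f (y, a)`, `y 0 = x`. -/
def IsTrajectory {n m : ℕ} (f : E n → E m → E n) (a : ℝ → E m) (x : E n) (t : ℝ)
    (y : ℝ → E n) : Prop :=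
  ContinuousOn y (Set.Icc 0 t) ∧
    ∀ τ ∈ Set.Icc 0 t, y τ = x + ∫ s in (0 : ℝ)..τ, f (y s) (a s)

/-- The trajectory of the control `a` that starts at `x` exists on `[0, t]` and is in the target
at time `t`. -/
def ReachesAt {n m : ℕ} (f : E n → E m → E n) (target : Set (E n)) (a : ℝ → E m) (x : E n)
    (t : ℝ) : Prop :=
  0 ≤ t ∧ ∃ y : ℝ → E n, IsTrajectory f a x t y ∧ y t ∈ target

/-- The first time `t_x(a)` at which the trajectory of the control `a` from `x` is in the target
(`∞` if it never is). -/
def hittingTime {n m : ℕ} (f : E n → E m → E n) (target : Set (E n)) (a : ℝ → E m)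
    (x : E n) : ℝ≥0∞ :=
  ⨅ (t : ℝ) (_ : ReachesAt f target a x t), ENNReal.ofReal t

/-- The minimum time function: the infimum of the hitting times over the controls in `U`. -/
def minTime {n m : ℕ} (f : E n → E m → E n) (target : Set (E n)) (U : Set (ℝ → E m))
    (x : E n) : ℝ≥0∞ :=
  ⨅ a ∈ U, hittingTime f target a x

/-- Small time local attainability of the target at `xbar`: for every `t > 0`, the point `xbar` is
interior to the set of points from which the target can be reached in time less than `t`. -/
def IsSTLA {n m : ℕ} (f : E n → E m → E n) (target : Set (E n)) (U : Set (ℝ → E m))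
    (xbar : E n) : Prop :=
  ∀ t : ℝ, 0 < t →
    xbar ∈ interior {x | ∃ a ∈ U, ∃ τ : ℝ, τ < t ∧ ReachesAt f target a x τ}

/-- The estimate `T(x) ≤ C |x - xbar| ^ s` for all `x` in a closed ball `B_r(xbar)`. -/
def HolderEstimate {n m : ℕ} (f : E n → E m → E n) (target : Set (E n)) (U : Set (ℝ → E m))
    (xbar : E n) (s : ℝ) : Prop :=
  ∃ C r : ℝ, 0 < C ∧ 0 < r ∧ ∀ x ∈ Metric.closedBall xbar r,
    minTime f target U x ≤ ENNReal.ofReal (C * ‖x - xbar‖ ^ s)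

/-! ### Affine systems and second order Hamiltonians -/

/-- The controlled vector field `f(x, a) = σ₀(x) + σ(x) a`, where `σ j` is the `j`-th column
of `σ`. -/
def affineField {n m : ℕ} (σ₀ : E n → E n) (σ : Fin m → E n → E n) (x : E n) (a : E m) : E n :=
  σ₀ x + ∑ j, a j • σ j x

/-- The second order Hamiltonian `H_{g,f} u (x) = (∇(∇u · f) · g)(x)`. -/
def secondHamiltonian {n : ℕ} (u : E n → ℝ) (g f : E n → E n) (x : E n) : ℝ :=
  fderiv ℝ (fun y => fderiv ℝ u y (f y)) x (g x)

/-- The matrix `S(x) = D(∇u σ) σ (x)`, with entries `S i j = H_{σ j, σ i} u (x)`. -/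
def matS {n m : ℕ} (u : E n → ℝ) (σ : Fin m → E n → E n) (x : E n) :
    Matrix (Fin m) (Fin m) ℝ :=
  Matrix.of fun i j => secondHamiltonian u (σ j) (σ i) x

/-- The symmetric part of `S(x)`. -/
def matSsym {n m : ℕ} (u : E n → ℝ) (σ : Fin m → E n → E n) (x : E n) :
    Matrix (Fin m) (Fin m) ℝ :=
  (1 / 2 : ℝ) • (matS u σ x + (matS u σ x).transpose)

/-- The symmetric `2m × 2m` block matrix `K(x)` with rows `(S*, ᵗS)` and `(S, S*)`, where `S*` is
the symmetric part of `S`. -/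
def matK {n m : ℕ} (u : E n → ℝ) (σ : Fin m → E n → E n) (x : E n) :
    Matrix (Fin m ⊕ Fin m) (Fin m ⊕ Fin m) ℝ :=
  Matrix.fromBlocks (matSsym u σ x) (matS u σ x).transpose (matS u σ x) (matSsym u σ x)

/-- Condition on pairs of vector fields: some bracket `[σ₀, σ j]` is not orthogonal to `∇u` at
`xbar`, or `K(xbar)` is not positive semidefinite. The bracket is `[f, g] = Dg f - Df g`. -/
def SwitchCondition {n m : ℕ} (u : E n → ℝ) (σ₀ : E n → E n) (σ : Fin m → E n → E n)
    (xbar : E n) : Prop :=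
  (∃ j, fderiv ℝ u xbar (VectorField.lieBracket ℝ σ₀ (σ j) xbar) ≠ 0) ∨
    ¬ (matK u σ xbar).PosSemidef

/-- Condition on a single vector field: `∇(∇u · f(·, a)) · f(·, a) < 0` at `xbar` for some constant
control `a` in the closed unit ball. -/
def SingleFieldCondition {n m : ℕ} (u : E n → ℝ) (σ₀ : E n → E n) (σ : Fin m → E n → E n)
    (xbar : E n) : Prop :=
  ∃ a ∈ Metric.closedBall (0 : E m) 1,
    secondHamiltonian u (fun x => affineField σ₀ σ x a) (fun x => affineField σ₀ σ x a) xbar < 0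

end AffineControl

end

/-! All fields are tangent at `xbar`, so the first order change of `u` along a trajectory is of size
distance times time, and second order terms decide.

Sufficiency: using a constant control `a` for time `t` and then `b` for time `t` changes `u` by `t ^
2 / 2 * switchRate` up to small errors. Its part quadratic in `(a, b)` is the form of `K`, its
linear part contains the brackets with the drift, and `a = b` gives the single field Hamiltonian;
hence (a) or (b) makes it negative for some pair (`exists_switchRate_neg`). A time of order `‖x -
xbar‖ ^ (1/2)` then compensates `u x - u xbar = O(‖x - xbar‖)`
(`exists_reachesAt_of_switchRate_neg`).

Necessity: if (a) fails, the second order Hamiltonians of `σ₀, σ₁, …, σₘ` form a symmetric matrix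
`Q`. The second order term is then an exact derivative, so it depends on the control only through
its integral `B t`: it equals `Q(B t, B t) / 2` (`exists_expansion_bound`). As the mean of the
control lies in the ball, failure of (b) makes this term nonnegative. What remains is a decrease of
at most `C (‖x - xbar‖ + t ^ 2) t`. Starting at distance `ε` in a direction of increase of `u`, a
decrease of order `ε` is needed, which `t = O(ε ^ s)` with `s > 1/3` cannot produce. -/

namespace AffineControl

open Set MeasureTheory Metric

/-! ### Calculus along Lipschitz curves and primitives -/

section Primitive

variable {V : Type*} [NormedAddCommGroup V] [NormedSpace ℝ V]

/-- One-sided mean value inequality with an almost everywhere bound on the derivative, for a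
`C¹` function of a Lipschitz curve. -/
lemma sub_le_of_ae_hasDerivAt_le [ProperSpace V] {z : ℝ → V} {K : NNReal} {t : ℝ} (ht : 0 ≤ t)
    (hz : LipschitzOnWith K z (Icc 0 t)) {G : V → ℝ} (hG : ContDiff ℝ 1 G) {M : ℝ}
    (hd : ∀ᵐ s, s ∈ Ioo 0 t → ∃ d, HasDerivAt (fun s => G (z s)) d s ∧ d ≤ M) :
    G (z t) - G (z 0) ≤ M * t := by
  have h0 : (0 : ℝ) ∈ Icc 0 t := ⟨le_rfl, ht⟩
  have hmaps : MapsTo z (Icc 0 t) (closedBall (z 0) (K * t)) := by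
    intro s hs
    rw [mem_closedBall]
    refine (hz.dist_le_mul s hs 0 h0).trans ?_
    gcongr
    rw [Real.dist_eq, sub_zero, abs_of_nonneg hs.1]
    exact hs.2
  obtain ⟨K', hK'⟩ := hG.contDiffOn.exists_lipschitzOnWith (by decide)
    (convex_closedBall (z 0) (K * t)) (isCompact_closedBall _ _)
  -- `G` is Lipschitz on a compact convex ball containing the curve, so the composite is absolutely
  -- continuous and is the integral of its a.e. derivative.
  have hac : AbsolutelyContinuousOnInterval (fun s => G (z s)) 0 t := by
    have := hK'.comp hz hmaps
    rw [← uIcc_of_le ht] at this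
    exact this.absolutelyContinuousOnInterval
  rw [← hac.integral_deriv_eq_sub]
  have : ∫ s in (0 : ℝ)..t, deriv (fun s => G (z s)) s ≤ ∫ _ in (0 : ℝ)..t, M := by
    apply intervalIntegral.integral_mono_ae_restrict ht hac.intervalIntegrable_deriv
      intervalIntegrable_const
    rw [Filter.EventuallyLE, ae_restrict_iff' measurableSet_Icc]
    filter_upwards [hd, (by simp [ae_iff] : ∀ᵐ x : ℝ, x ≠ 0),
      (by simp [ae_iff] : ∀ᵐ x : ℝ, x ≠ t)] with s hs h1 h2 hmem
    obtain ⟨d, hd, hle⟩ := hs ⟨lt_of_le_of_ne hmem.1 h1.symm, lt_of_le_of_ne hmem.2 h2⟩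
    rwa [hd.deriv]
  simpa [mul_comm] using this

lemma abs_sub_le_of_ae_hasDerivAt [ProperSpace V] {z : ℝ → V} {K : NNReal} {t : ℝ} (ht : 0 ≤ t)
    (hz : LipschitzOnWith K z (Icc 0 t)) {G : V → ℝ} (hG : ContDiff ℝ 1 G) {M : ℝ}
    (hd : ∀ᵐ s, s ∈ Ioo 0 t → ∃ d, HasDerivAt (fun s => G (z s)) d s ∧ |d| ≤ M) :
    |G (z t) - G (z 0)| ≤ M * t := by
  rw [abs_le]
  constructor
  · have := sub_le_of_ae_hasDerivAt_le ht hz hG.neg (M := M) (by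
      filter_upwards [hd] with s hs hmem
      obtain ⟨d, h1, h2⟩ := hs hmem
      exact ⟨-d, h1.neg, (neg_le_abs d).trans h2⟩)
    linarith
  · exact sub_le_of_ae_hasDerivAt_le ht hz hG (M := M) (by
      filter_upwards [hd] with s hs hmem
      obtain ⟨d, h1, h2⟩ := hs hmem
      exact ⟨d, h1, (le_abs_self d).trans h2⟩)

omit [NormedSpace ℝ V] in
lemma intervalIntegrable_of_bound {h : ℝ → V} {t M : ℝ} (ht : 0 ≤ t)
    (hm : AEStronglyMeasurable h (volume.restrict (Icc 0 t))) (hb : ∀ s ∈ Icc 0 t, ‖h s‖ ≤ M) :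
    IntervalIntegrable h volume 0 t := by
  rw [intervalIntegrable_iff_integrableOn_Icc_of_le ht]
  exact IntegrableOn.of_bound (by simp) hm M
    ((ae_restrict_iff' measurableSet_Icc).2 (Filter.Eventually.of_forall hb))

lemma lipschitzOnWith_of_eq_integral {h y : ℝ → V} {x : V} {t : ℝ} {M : NNReal} (ht : 0 ≤ t)
    (hi : IntervalIntegrable h volume 0 t) (hb : ∀ s ∈ Icc 0 t, ‖h s‖ ≤ M)
    (hy : ∀ s ∈ Icc 0 t, y s = x + ∫ r in (0 : ℝ)..s, h r) :
    LipschitzOnWith M y (Icc 0 t) := by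
  refine LipschitzOnWith.of_dist_le_mul fun s hs r hr => ?_
  have hsub : ∀ s ∈ Icc 0 t, IntervalIntegrable h volume 0 s := fun s hs =>
    hi.mono_set (by rw [uIcc_of_le hs.1, uIcc_of_le ht]; exact Icc_subset_Icc_right hs.2)
  rw [hy s hs, hy r hr, dist_add_left, dist_eq_norm,
    intervalIntegral.integral_interval_sub_left (hsub s hs) (hsub r hr), Real.dist_eq]
  refine intervalIntegral.norm_integral_le_of_norm_le_const fun w hw => hb w ?_
  have := uIoc_subset_uIcc hw
  exact (uIcc_subset_Icc hr hs) this

lemma ae_hasDerivAt_of_eq_integral [CompleteSpace V] {h y : ℝ → V} {x : V} {t : ℝ} (ht : 0 ≤ t)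
    (hi : IntervalIntegrable h volume 0 t)
    (hy : ∀ s ∈ Icc 0 t, y s = x + ∫ r in (0 : ℝ)..s, h r) :
    ∀ᵐ s, s ∈ Ioo 0 t → HasDerivAt y (h s) s := by
  filter_upwards [hi.ae_hasDerivAt_integral] with s hs hmem
  have h1 := hs (by rw [uIcc_of_le ht]; exact Ioo_subset_Icc_self hmem) 0 (by simp)
  refine (h1.const_add x).congr_of_eventuallyEq ?_
  filter_upwards [Ioo_mem_nhds hmem.1 hmem.2] with r hr
  exact hy r (Ioo_subset_Icc_self hr)

end Primitive

/-! ### A priori bounds on trajectories -/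

section Trajectory

variable {n m : ℕ} {f : E n → E m → E n} {a : ℝ → E m} {x xbar : E n} {t : ℝ} {y : ℝ → E n}

lemma IsTrajectory.apply_zero (h : IsTrajectory f a x t y) (ht : 0 ≤ t) : y 0 = x := by
  simpa using h.2 0 ⟨le_rfl, ht⟩

/-- A trajectory does not leave a ball before the time that a bound on its velocity allows. -/
lemma IsTrajectory.norm_sub_le (h : IsTrajectory f a x t y) {M ρ : ℝ}
    (hM0 : 0 ≤ M) (hM : ∀ z ∈ closedBall xbar ρ, ∀ s, ‖f z (a s)‖ ≤ M) (hx : ‖x - xbar‖ + M * t < ρ) :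
    ∀ s ∈ Icc 0 t, ‖y s - x‖ ≤ M * s ∧ y s ∈ closedBall xbar ρ := by
  have key : ∀ s ∈ Icc 0 t, (∀ r ∈ Ico 0 s, y r ∈ closedBall xbar ρ) → ‖y s - x‖ ≤ M * s := by
    intro s hs hr
    rw [h.2 s hs, add_sub_cancel_left]
    have := intervalIntegral.norm_integral_le_of_norm_le_const_ae (a := 0) (b := s) (C := M)
      (f := fun r => f (y r) (a r)) (by
        filter_upwards [(by simp [ae_iff] : ∀ᵐ x : ℝ, x ≠ s)] with r hrs hmem
        rw [uIoc_of_le hs.1] at hmem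
        exact hM _ (hr r ⟨hmem.1.le, lt_of_le_of_ne hmem.2 hrs⟩) _)
    simpa [abs_of_nonneg hs.1] using this
  have hin : ∀ s ∈ Icc 0 t, dist (y s) xbar < ρ := by
    by_contra! hcon
    have hcl : IsCompact (Icc 0 t ∩ (fun s => dist (y s) xbar) ⁻¹' Ici ρ) := by
      refine isCompact_Icc.of_isClosed_subset ?_ inter_subset_left
      exact ContinuousOn.preimage_isClosed_of_isClosed (continuous_id.dist continuous_const |>.comp_continuousOn h.1) isClosed_Icc
        isClosed_Ici
    -- At the first time of distance at least `ρ` the velocity bound still holds on `[0, s)`, which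
    -- is all that `key` needs.
    obtain ⟨s, ⟨hs, hsρ⟩, hmin⟩ := hcl.exists_isLeast (by
      obtain ⟨s, hs, hsρ⟩ := hcon
      exact ⟨s, hs, hsρ⟩)
    have h1 := key s hs fun r hr => by
      by_contra hr'
      rw [mem_closedBall, not_le] at hr'
      exact absurd (hmin ⟨⟨hr.1, hr.2.le.trans hs.2⟩, hr'.le⟩) (not_le.2 hr.2)
    have h2 : dist (y s) xbar ≤ ‖y s - x‖ + ‖x - xbar‖ := by
      rw [dist_eq_norm]; exact norm_sub_le_norm_sub_add_norm_sub _ _ _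
    have h3 : M * s ≤ M * t := by gcongr; exact hs.2
    have h4 : ρ ≤ dist (y s) xbar := hsρ
    linarith
  intro s hs
  exact ⟨key s hs fun r hr => (hin r ⟨hr.1, hr.2.le.trans hs.2⟩).le, (hin s hs).le⟩

lemma IsTrajectory.aestronglyMeasurable (h : IsTrajectory f a x t y)
    (hf : Continuous (Function.uncurry f)) (ha : Measurable a) :
    AEStronglyMeasurable (fun s => f (y s) (a s)) (volume.restrict (Icc 0 t)) := by
  have h1 : AEMeasurable y (volume.restrict (Icc 0 t)) := h.1.aemeasurable measurableSet_Icc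
  exact (hf.measurable.comp_aemeasurable (h1.prodMk ha.aemeasurable)).aestronglyMeasurable

end Trajectory

end AffineControl

namespace AffineControl

open Set Metric

/-! ### Algebra of the second order Hamiltonians -/

section Algebra

variable {n m : ℕ} {u : E n → ℝ} {σ₀ : E n → E n} {σ : Fin m → E n → E n} {x : E n}

lemma secondHamiltonian_sum {ι : Type*} [Fintype ι] {F : ι → E n → E n}
    (hu : ContDiff ℝ 2 u) (hF : ∀ i, ContDiff ℝ 1 (F i)) (a b : ι → ℝ) (x : E n) :
    secondHamiltonian u (fun y => ∑ i, a i • F i y) (fun y => ∑ i, b i • F i y) x =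
      ∑ i, ∑ j, a i * b j * secondHamiltonian u (F i) (F j) x := by
  have hd : ∀ j, DifferentiableAt ℝ (fun y => fderiv ℝ u y (F j y)) x := fun j =>
    (((hu.fderiv_right (m := 1) (by norm_num)).clm_apply (hF j)).differentiable
      (by norm_num)).differentiableAt
  have h1 : (fun y => fderiv ℝ u y (∑ j, b j • F j y)) =
      fun y => ∑ j, b j • fderiv ℝ u y (F j y) := by
    ext y; simp
  have h2 : ∀ j, fderiv ℝ (fun y => b j • fderiv ℝ u y (F j y)) x =
      b j • fderiv ℝ (fun y => fderiv ℝ u y (F j y)) x := fun j =>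
    fderiv_fun_const_smul (hd j) (b j)
  unfold secondHamiltonian
  rw [h1, fderiv_fun_sum fun j _ => (hd j).fun_const_smul (b j)]
  simp only [h2, map_sum, map_smul, sum_apply, smul_apply]
  simp only [smul_eq_mul, Finset.mul_sum, mul_assoc]

/-- The fields `σ₀, σ₁, …, σₘ` as one family. -/
def extField (σ₀ : E n → E n) (σ : Fin m → E n → E n) (i : Option (Fin m)) : E n → E n :=
  i.elim σ₀ σ

/-- The control extended by the constant coefficient `1` of the drift. -/
noncomputable def extControl (a : E m) (i : Option (Fin m)) : ℝ :=
  i.elim 1 a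

lemma affineField_eq_sum (σ₀ : E n → E n) (σ : Fin m → E n → E n) (x : E n) (a : E m) :
    affineField σ₀ σ x a = ∑ i, extControl a i • extField σ₀ σ i x := by
  simp [affineField, extControl, extField, Fintype.sum_option]

lemma contDiff_extField (hσ₀ : ContDiff ℝ 2 σ₀) (hσ : ∀ j, ContDiff ℝ 2 (σ j))
    (i : Option (Fin m)) : ContDiff ℝ 2 (extField σ₀ σ i) := by
  cases i
  exacts [hσ₀, hσ _]

lemma abs_extControl_le {a : E m} (ha : a ∈ closedBall (0 : E m) 1) (i : Option (Fin m)) :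
    |extControl a i| ≤ 1 := by
  cases i with
  | none => simp [extControl]
  | some j =>
    rw [mem_closedBall_zero_iff] at ha
    exact (PiLp.norm_apply_le a j).trans ha

/-- The bilinear part of the second order Hamiltonian in the controls. -/
noncomputable def hamiltonianForm (u : E n → ℝ) (σ : Fin m → E n → E n) (x : E n) (a b : Fin m → ℝ) : ℝ :=
  ∑ i, ∑ j, a i * b j * secondHamiltonian u (σ i) (σ j) x

lemma secondHamiltonian_affineField (hu : ContDiff ℝ 2 u) (hσ₀ : ContDiff ℝ 2 σ₀)
    (hσ : ∀ j, ContDiff ℝ 2 (σ j)) (a b : E m) (x : E n) :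
    secondHamiltonian u (fun y => affineField σ₀ σ y a) (fun y => affineField σ₀ σ y b) x =
      secondHamiltonian u σ₀ σ₀ x + ∑ j, a j * secondHamiltonian u (σ j) σ₀ x +
        ∑ j, b j * secondHamiltonian u σ₀ (σ j) x + hamiltonianForm u σ x a b := by
  simp only [affineField_eq_sum]
  rw [secondHamiltonian_sum hu fun i => (contDiff_extField hσ₀ hσ i).of_le (by norm_num)]
  simp only [Fintype.sum_option, extControl, extField, Option.elim, hamiltonianForm,
    Finset.sum_add_distrib, one_mul, mul_one]
  ring

lemma isHermitian_matK (u : E n → ℝ) (σ : Fin m → E n → E n) (x : E n) :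
    (matK u σ x).IsHermitian := by
  have h : (matSsym u σ x).IsHermitian := by
    ext i j
    simp [matSsym, ← mul_add, add_comm]
  exact h.fromBlocks (by ext i j; simp) h

/-- This explains the shape of `K`: it is the matrix of the control-quadratic part of `switchRate`.
The order of the two controls matters in the cross term, so the skew part of `S` enters. -/
lemma dotProduct_matK_mulVec (u : E n → ℝ) (σ : Fin m → E n → E n) (x : E n)
    (a b : Fin m → ℝ) :
    Sum.elim a b ⬝ᵥ (matK u σ x).mulVec (Sum.elim a b) =
      hamiltonianForm u σ x a a + 2 * hamiltonianForm u σ x a b + hamiltonianForm u σ x b b := by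
  have hS : ∀ c d : Fin m → ℝ, d ⬝ᵥ (matS u σ x).mulVec c = hamiltonianForm u σ x c d := by
    intro c d
    simp only [dotProduct, Matrix.mulVec, matS, Matrix.of_apply, hamiltonianForm, Finset.mul_sum]
    rw [Finset.sum_comm]
    exact Finset.sum_congr rfl fun i _ => Finset.sum_congr rfl fun j _ => by ring
  have hT : ∀ c d : Fin m → ℝ, d ⬝ᵥ (matS u σ x).transpose.mulVec c =
      hamiltonianForm u σ x d c := by
    intro c d
    rw [Matrix.dotProduct_mulVec, Matrix.vecMul_transpose, dotProduct_comm, hS]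
  have hs : ∀ c : Fin m → ℝ, c ⬝ᵥ (matSsym u σ x).mulVec c = hamiltonianForm u σ x c c := by
    intro c
    rw [matSsym, Matrix.smul_mulVec, Matrix.add_mulVec, dotProduct_smul, dotProduct_add, hS, hT,
      smul_eq_mul]
    ring
  rw [matK, Matrix.fromBlocks_mulVec, sumElim_dotProduct_sumElim, dotProduct_add,
    dotProduct_add, Sum.elim_comp_inl, Sum.elim_comp_inr, hs, hs, hS, hT]
  ring

lemma hamiltonianForm_smul (u : E n → ℝ) (σ : Fin m → E n → E n) (x : E n) (c : ℝ)
    (a b : Fin m → ℝ) :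
    hamiltonianForm u σ x (c • a) (c • b) = c ^ 2 * hamiltonianForm u σ x a b := by
  simp only [hamiltonianForm, Finset.mul_sum, Pi.smul_apply, smul_eq_mul]
  exact Finset.sum_congr rfl fun i _ => Finset.sum_congr rfl fun j _ => by ring

/-- If `K` is positive semidefinite, then `S` is symmetric. -/
lemma secondHamiltonian_comm_of_posSemidef (h : (matK u σ x).PosSemidef) (i j : Fin m) :
    secondHamiltonian u (σ i) (σ j) x = secondHamiltonian u (σ j) (σ i) x := by
  set e : Fin m → ℝ := Pi.single i 1
  -- The form of `K` vanishes at `(e, -e)`, so semidefiniteness puts this vector in the kernel;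
  -- entry `j` of its image is half of `S j i - S i j`.
  have h0 : Sum.elim e (-e) ⬝ᵥ (matK u σ x).mulVec (Sum.elim e (-e)) = 0 := by
    rw [dotProduct_matK_mulVec]
    simp [hamiltonianForm]
    ring
  have h1 := (h.dotProduct_mulVec_zero_iff (Sum.elim e (-e))).1 (by simpa using h0)
  have h2 := congrFun h1 (Sum.inl j)
  simp [matK, Matrix.fromBlocks_mulVec, e, Matrix.mulVec_neg, matSsym, matS] at h2
  linarith

lemma fderiv_lieBracket (hu : ContDiff ℝ 2 u) {f g : E n → E n} (hf : ContDiff ℝ 2 f)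
    (hg : ContDiff ℝ 2 g) (x : E n) :
    fderiv ℝ u x (VectorField.lieBracket ℝ f g x) =
      secondHamiltonian u f g x - secondHamiltonian u g f x :=
  VectorField.fderiv_apply_lieBracket_of_isSymmSndFDerivAt hu.contDiffAt
    (hu.contDiffAt.isSymmSndFDerivAt (by simp))
    (hg.differentiable (by norm_num)).differentiableAt
    (hf.differentiable (by norm_num)).differentiableAt

/-- Vanishing brackets give the symmetry of the entries that involve the drift, semidefiniteness of
`K` that of the others. -/
lemma secondHamiltonian_extField_comm (hu : ContDiff ℝ 2 u) (hσ₀ : ContDiff ℝ 2 σ₀)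
    (hσ : ∀ j, ContDiff ℝ 2 (σ j)) (h : ¬ SwitchCondition u σ₀ σ x) (i j : Option (Fin m)) :
    secondHamiltonian u (extField σ₀ σ i) (extField σ₀ σ j) x =
      secondHamiltonian u (extField σ₀ σ j) (extField σ₀ σ i) x := by
  rw [SwitchCondition, not_or, not_exists, not_not] at h
  have h1 : ∀ k, secondHamiltonian u σ₀ (σ k) x = secondHamiltonian u (σ k) σ₀ x := fun k => by
    have := h.1 k
    rw [not_not, fderiv_lieBracket hu hσ₀ (hσ k)] at this
    exact sub_eq_zero.1 this
  cases i <;> cases j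
  exacts [rfl, h1 _, (h1 _).symm, secondHamiltonian_comm_of_posSemidef h.2 _ _]

/-- Twice the second order rate of decrease of `u` when the constant controls `a` and then `b` are
used for equal times. -/
noncomputable def switchRate (u : E n → ℝ) (σ₀ : E n → E n) (σ : Fin m → E n → E n) (x : E n)
    (a b : E m) : ℝ :=
  secondHamiltonian u (fun y => affineField σ₀ σ y a) (fun y => affineField σ₀ σ y a) x +
    2 * secondHamiltonian u (fun y => affineField σ₀ σ y a) (fun y => affineField σ₀ σ y b) x +
    secondHamiltonian u (fun y => affineField σ₀ σ y b) (fun y => affineField σ₀ σ y b) x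

lemma switchRate_eq (hu : ContDiff ℝ 2 u) (hσ₀ : ContDiff ℝ 2 σ₀)
    (hσ : ∀ j, ContDiff ℝ 2 (σ j)) (a b : E m) (x : E n) :
    switchRate u σ₀ σ x a b = 4 * secondHamiltonian u σ₀ σ₀ x +
      (∑ j, (3 * a j + b j) * secondHamiltonian u (σ j) σ₀ x +
        ∑ j, (a j + 3 * b j) * secondHamiltonian u σ₀ (σ j) x) +
      (hamiltonianForm u σ x a a + 2 * hamiltonianForm u σ x a b +
        hamiltonianForm u σ x b b) := by
  simp only [switchRate, secondHamiltonian_affineField hu hσ₀ hσ, add_mul,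
    Finset.sum_add_distrib, mul_assoc, ← Finset.mul_sum]
  ring

/-- For a bracket, `b = -a` along `e_j` cancels the quadratic part and leaves a multiple of the
bracket term, whose sign is free. For `K`, a vector of negative form is scaled into the ball, with
the sign that makes the linear part nonpositive. For a single field, `b = a` multiplies its
Hamiltonian by four. -/
lemma exists_switchRate_neg (hu : ContDiff ℝ 2 u) (hσ₀ : ContDiff ℝ 2 σ₀)
    (hσ : ∀ j, ContDiff ℝ 2 (σ j)) (hdrift : secondHamiltonian u σ₀ σ₀ x ≤ 0)
    (h : SwitchCondition u σ₀ σ x ∨ SingleFieldCondition u σ₀ σ x) :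
    ∃ a ∈ closedBall (0 : E m) 1, ∃ b ∈ closedBall (0 : E m) 1,
      switchRate u σ₀ σ x a b < 0 := by
  rcases h with (⟨j, hj⟩ | hK) | ⟨a, ha, hneg⟩
  · rw [fderiv_lieBracket hu hσ₀ (hσ j)] at hj
    have key : ∀ c : ℝ, switchRate u σ₀ σ x (EuclideanSpace.single j c)
        (-EuclideanSpace.single j c) = 4 * secondHamiltonian u σ₀ σ₀ x -
          2 * c * (secondHamiltonian u σ₀ (σ j) x - secondHamiltonian u (σ j) σ₀ x) := by
      intro c
      rw [switchRate_eq hu hσ₀ hσ]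
      simp [hamiltonianForm, Finset.sum_add_distrib, add_mul]
      ring
    rcases lt_or_gt_of_ne hj with hlt | hgt
    · refine ⟨EuclideanSpace.single j (-1), by simp, -EuclideanSpace.single j (-1), by simp, ?_⟩
      rw [key]; linarith
    · refine ⟨EuclideanSpace.single j 1, by simp, -EuclideanSpace.single j 1, by simp, ?_⟩
      rw [key]; linarith
  · rw [Matrix.posSemidef_iff_dotProduct_mulVec, not_and, not_forall] at hK
    obtain ⟨v, hv⟩ := hK (isHermitian_matK u σ x)
    rw [star_trivial, not_le, ← Sum.elim_comp_inl_inr v, dotProduct_matK_mulVec] at hv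
    set a : E m := WithLp.toLp 2 (v ∘ Sum.inl)
    set b : E m := WithLp.toLp 2 (v ∘ Sum.inr)
    set N : ℝ := 1 + ‖a‖ + ‖b‖ with hN
    have hNpos : 0 < N := by positivity
    have hball : ∀ c : ℝ, |c| = N⁻¹ → ∀ w : E m, ‖w‖ ≤ N → c • w ∈ closedBall (0 : E m) 1 := by
      intro c hc w hw
      rw [mem_closedBall_zero_iff, norm_smul, Real.norm_eq_abs, hc, inv_mul_le_iff₀ hNpos]
      simpa using hw
    have haN : ‖a‖ ≤ N := by rw [hN]; linarith [norm_nonneg a, norm_nonneg b]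
    have hbN : ‖b‖ ≤ N := by rw [hN]; linarith [norm_nonneg a, norm_nonneg b]
    set ℓ : ℝ := ∑ j, (3 * a j + b j) * secondHamiltonian u (σ j) σ₀ x +
        ∑ j, (a j + 3 * b j) * secondHamiltonian u σ₀ (σ j) x with hℓ
    have key : ∀ c : ℝ, c ≠ 0 → c * ℓ ≤ 0 → switchRate u σ₀ σ x (c • a) (c • b) < 0 := by
      intro c hc hcℓ
      have h1 : switchRate u σ₀ σ x (c • a) (c • b) = 4 * secondHamiltonian u σ₀ σ₀ x + c * ℓ +
          c ^ 2 * (hamiltonianForm u σ x a a + 2 * hamiltonianForm u σ x a b +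
            hamiltonianForm u σ x b b) := by
        rw [switchRate_eq hu hσ₀ hσ]
        simp only [PiLp.smul_apply, smul_eq_mul, WithLp.ofLp_smul, hamiltonianForm_smul]
        rw [hℓ, mul_add, Finset.mul_sum, Finset.mul_sum]
        congr 1
        · congr 2 <;> exact Finset.sum_congr rfl fun j _ => by ring
        · ring
      have h2 : c ^ 2 * (hamiltonianForm u σ x a a + 2 * hamiltonianForm u σ x a b +
            hamiltonianForm u σ x b b) < 0 := mul_neg_of_pos_of_neg (by positivity) hv
      linarith
    rcases le_total ℓ 0 with hle | hge
    · have hc : |N⁻¹| = N⁻¹ := abs_of_pos (by positivity)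
      exact ⟨_, hball _ hc a haN, _, hball _ hc b hbN, key N⁻¹ (by positivity)
        (mul_nonpos_of_nonneg_of_nonpos (by positivity) hle)⟩
    · have hc : |-N⁻¹| = N⁻¹ := by rw [abs_neg]; exact abs_of_pos (by positivity)
      exact ⟨_, hball _ hc a haN, _, hball _ hc b hbN, key (-N⁻¹) (by simp [hNpos.ne'])
        (mul_nonpos_of_nonpos_of_nonneg (by simp [hNpos.le]) hge)⟩
  · refine ⟨a, ha, a, ha, ?_⟩
    rw [switchRate]
    linarith

end Algebra

end AffineControl

namespace AffineControl

open Set MeasureTheory Metric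

/-! ### First and second order estimates, existence and concatenation -/

section Trajectory

variable {n m : ℕ} {f : E n → E m → E n} {a : ℝ → E m} {x xbar : E n} {t : ℝ} {y : ℝ → E n}

lemma IsTrajectory.mono (h : IsTrajectory f a x t y) {r : ℝ} (hr : r ≤ t) :
    IsTrajectory f a x r y :=
  ⟨h.1.mono (Icc_subset_Icc_right hr), fun τ hτ => h.2 τ ⟨hτ.1, hτ.2.trans hr⟩⟩

lemma IsTrajectory.regularity (h : IsTrajectory f a x t y) (ht : 0 ≤ t)
    (hf : Continuous (Function.uncurry f)) (ha : IsMeasurableControl a) :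
    (∃ K : NNReal, LipschitzOnWith K y (Icc 0 t)) ∧
      ∀ᵐ s, s ∈ Ioo 0 t → HasDerivAt y (f (y s) (a s)) s := by
  obtain ⟨M, hM⟩ := ((isCompact_Icc.image_of_continuousOn h.1).prod
    (isCompact_closedBall (0 : E m) 1)).exists_bound_of_continuousOn hf.continuousOn
  have hb : ∀ s ∈ Icc 0 t, ‖f (y s) (a s)‖ ≤ M := fun s hs =>
    hM (y s, a s) ⟨mem_image_of_mem _ hs, ha.2 s⟩
  have hi := intervalIntegrable_of_bound ht (h.aestronglyMeasurable hf ha.1) hb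
  exact ⟨⟨M.toNNReal, lipschitzOnWith_of_eq_integral ht hi
    (fun s hs => (hb s hs).trans (Real.le_coe_toNNReal M)) h.2⟩,
    ae_hasDerivAt_of_eq_integral ht hi h.2⟩

lemma IsTrajectory.sub_le (h : IsTrajectory f a x t y) (ht : 0 ≤ t)
    (hf : Continuous (Function.uncurry f)) (ha : IsMeasurableControl a) {w : E n → ℝ}
    (hw : ContDiff ℝ 1 w) {M : ℝ}
    (hM : ∀ s ∈ Ioo 0 t, fderiv ℝ w (y s) (f (y s) (a s)) ≤ M) :
    w (y t) - w x ≤ M * t := by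
  obtain ⟨⟨K, hK⟩, hd⟩ := h.regularity ht hf ha
  have := sub_le_of_ae_hasDerivAt_le ht hK hw (M := M) (by
    filter_upwards [hd] with s hs hmem
    exact ⟨_, ((hw.differentiable (by norm_num)).differentiableAt.hasFDerivAt.comp_hasDerivAt s
      (hs hmem)), hM s hmem⟩)
  rwa [h.apply_zero ht] at this

/-- Second order estimate along the trajectory of a constant control. -/
lemma IsTrajectory.sub_le_second {c : E m} (h : IsTrajectory f (fun _ => c) x t y) (ht : 0 ≤ t)
    (hf : Continuous (Function.uncurry f)) (hc : c ∈ closedBall (0 : E m) 1) {u : E n → ℝ}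
    (hu : ContDiff ℝ 1 u) (hp : ContDiff ℝ 1 fun z => fderiv ℝ u z (f z c)) {M : ℝ}
    (hM : ∀ s ∈ Icc 0 t,
      secondHamiltonian u (fun z => f z c) (fun z => f z c) (y s) ≤ M) :
    u (y t) - u x ≤ t * fderiv ℝ u x (f x c) + t ^ 2 / 2 * M := by
  have ha : IsMeasurableControl fun _ : ℝ => c := ⟨measurable_const, fun _ => hc⟩
  obtain ⟨⟨K, hK⟩, hd⟩ := h.regularity ht hf ha
  set p₀ := fderiv ℝ u x (f x c)
  -- Time is adjoined as a coordinate, so that `u` minus its quadratic majorant in time is a `C¹`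
  -- function of the curve.
  have hz : LipschitzOnWith (max K 1) (fun s => (y s, s)) (Icc 0 t) :=
    hK.prodMk LipschitzWith.id.lipschitzOnWith
  have hG : ContDiff ℝ 1 fun z : E n × ℝ => u z.1 - z.2 * p₀ - z.2 ^ 2 / 2 * M := by fun_prop
  have := sub_le_of_ae_hasDerivAt_le ht hz hG (M := 0) (by
    filter_upwards [hd] with s hs hmem
    refine ⟨fderiv ℝ u (y s) (f (y s) c) - 1 * p₀ - (2 * s ^ 1 * 1) / 2 * M, ?_, ?_⟩
    · exact (((hu.differentiable (by norm_num)).differentiableAt.hasFDerivAt.comp_hasDerivAt s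
        (hs hmem)).sub ((hasDerivAt_id s).mul_const p₀)).sub
          ((((hasDerivAt_id s).pow 2).div_const 2).mul_const M)
    · have := (h.mono hmem.2.le).sub_le hmem.1.le hf ha hp (M := M)
        (fun r hr => hM r ⟨hr.1.le, (hr.2.trans hmem.2).le⟩)
      linarith)
  simp only [h.apply_zero ht] at this
  linarith

/-- The existence time is uniform in the starting point because the second arc starts at the
endpoint of the first. -/
lemma exists_isTrajectory_const {c : E m} (hf : ContDiff ℝ 1 fun z => f z c) (xbar : E n) :
    ∃ r > 0, ∃ ε > 0, ∀ x ∈ closedBall xbar r, ∀ t ≤ ε,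
      ∃ y, IsTrajectory f (fun _ => c) x t y := by
  obtain ⟨r, hr, ε, hε, H⟩ :=
    hf.contDiffAt.exists_forall_mem_closedBall_exists_eq_forall_mem_Ioo_hasDerivAt
      (x₀ := xbar) 0
  refine ⟨r, hr, ε / 2, half_pos hε, fun x hx t ht => ?_⟩
  obtain ⟨y, hy0, hy⟩ := H x hx
  have hd : ∀ s ∈ Icc 0 t, HasDerivAt y (f (y s) c) s := fun s hs =>
    hy s ⟨by linarith [hs.1], by linarith [hs.2]⟩
  have hcont : ContinuousOn y (Icc 0 t) := fun s hs => (hd s hs).continuousAt.continuousWithinAt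
  refine ⟨y, hcont, fun τ hτ => ?_⟩
  have hsub : uIcc 0 τ ⊆ Icc 0 t := by
    rw [uIcc_of_le hτ.1]; exact Icc_subset_Icc_right hτ.2
  rw [intervalIntegral.integral_eq_sub_of_hasDerivAt (fun s hs => hd s (hsub hs))
    ((hf.continuous.comp_continuousOn (hcont.mono hsub)).intervalIntegrable), hy0]
  abel

/-- The control switches on `s < t` to fit the intervals `(s, t]` of `IsPiecewiseConstantControl`.
The curve may branch on `s ≤ t`, since the arcs agree at `t` and one time is negligible in the
integrals. -/
lemma IsTrajectory.concat {c d : E m} {t' : ℝ} {y' : ℝ → E n}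
    (hfc : Continuous fun z => f z c) (hfd : Continuous fun z => f z d)
    (h : IsTrajectory f (fun _ => c) x t y) (h' : IsTrajectory f (fun _ => d) (y t) t' y')
    (ht : 0 ≤ t) (ht' : 0 ≤ t') :
    IsTrajectory f (fun s => if s < t then c else d) x (t + t')
      (fun s => if s ≤ t then y s else y' (s - t)) := by
  set Y : ℝ → E n := fun s => if s ≤ t then y s else y' (s - t) with hY
  have hY1 : ∀ s ≤ t, Y s = y s := fun s hs => if_pos hs
  have hY2 : ∀ s, t ≤ s → Y s = y' (s - t) := fun s hs => by
    rcases hs.eq_or_lt with rfl | hlt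
    · rw [hY1 t le_rfl, sub_self, h'.apply_zero ht']
    · exact if_neg (not_le.2 hlt)
  have hshift : ContinuousOn (fun s => y' (s - t)) (Icc t (t + t')) :=
    h'.1.comp (by fun_prop) fun s hs => ⟨by linarith [hs.1], by linarith [hs.2]⟩
  have hne : ∀ᵐ s : ℝ, s ≠ t := by simp [ae_iff]
  have hae : ∀ τ ∈ Icc 0 t, ∀ᵐ s, s ∈ uIoc 0 τ →
      f (y s) c = f (Y s) (if s < t then c else d) := by
    intro τ hτ
    filter_upwards [hne] with s hs hmem
    rw [uIoc_of_le hτ.1] at hmem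
    have hst : s < t := lt_of_le_of_ne (hmem.2.trans hτ.2) hs
    rw [if_pos hst, hY1 s hst.le]
  have h1 : ∀ τ ∈ Icc 0 t, Y τ = x + ∫ s in (0 : ℝ)..τ, f (Y s) (if s < t then c else d) := by
    intro τ hτ
    rw [hY1 τ hτ.2, h.2 τ hτ, intervalIntegral.integral_congr_ae (hae τ hτ)]
  refine ⟨?_, fun τ hτ => ?_⟩
  · rw [← Icc_union_Icc_eq_Icc ht (le_add_of_nonneg_right ht')]
    exact (h.1.congr fun s hs => hY1 s hs.2).union_of_isClosed
      (hshift.congr fun s hs => hY2 s hs.1) isClosed_Icc isClosed_Icc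
  · rcases le_total τ t with hle | hge
    · exact h1 τ ⟨hτ.1, hle⟩
    · have hmem : τ - t ∈ Icc 0 t' := ⟨by linarith, by linarith [hτ.2]⟩
      have hcongr : ∀ s ∈ uIoc t τ, f (y' (s - t)) d = f (Y s) (if s < t then c else d) := by
        intro s hs
        rw [uIoc_of_le hge] at hs
        rw [if_neg (not_lt.2 hs.1.le), hY2 s hs.1.le]
      have hi1 : IntervalIntegrable (fun s => f (Y s) (if s < t then c else d)) volume 0 t := by
        have : IntervalIntegrable (fun s => f (y s) c) volume 0 t :=
          (hfc.comp_continuousOn (by rw [uIcc_of_le ht]; exact h.1)).intervalIntegrable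
        exact this.congr_ae ((ae_restrict_iff' measurableSet_uIoc).2 (hae t ⟨ht, le_rfl⟩))
      have hi2 : IntervalIntegrable (fun s => f (Y s) (if s < t then c else d)) volume t τ := by
        have : IntervalIntegrable (fun s => f (y' (s - t)) d) volume t τ :=
          (hfd.comp_continuousOn (hshift.mono (by
            rw [uIcc_of_le hge]; exact Icc_subset_Icc_right hτ.2))).intervalIntegrable
        exact this.congr_ae ((ae_restrict_iff' measurableSet_uIoc).2
          (Filter.Eventually.of_forall hcongr))
      rw [← intervalIntegral.integral_add_adjacent_intervals hi1 hi2, ← add_assoc,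
        ← h1 t ⟨ht, le_rfl⟩, hY1 t le_rfl, hY2 τ hge, h'.2 _ hmem]
      congr 1
      rw [← intervalIntegral.integral_congr_ae (Filter.Eventually.of_forall hcongr),
        intervalIntegral.integral_comp_sub_right (fun s => f (y' s) d), sub_self]

lemma isPiecewiseConstantControl_ite {c d : E m} (hc : c ∈ closedBall (0 : E m) 1)
    (hd : d ∈ closedBall (0 : E m) 1) (t : ℝ) :
    IsPiecewiseConstantControl fun s : ℝ => if s < t then c else d := by
  refine ⟨⟨{t}, fun s r hsr hF => ?_⟩, fun s => ?_⟩
  · have := hF t (Finset.mem_singleton_self t)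
    rw [mem_Ioc, not_and, not_le] at this
    by_cases hst : s < t
    · simp [hst, this hst]
    · simp [hst, not_lt.2 ((not_lt.1 hst).trans hsr)]
  · dsimp only
    split_ifs
    exacts [hc, hd]

end Trajectory

lemma exists_abs_sub_le {n : ℕ} {G : E n → ℝ} (hG : ContDiff ℝ 1 G) (xbar : E n) (R : ℝ) :
    ∃ L, 0 ≤ L ∧ ∀ x ∈ closedBall xbar R, |G x - G xbar| ≤ L * ‖x - xbar‖ := by
  rcases lt_or_ge R 0 with hR | hR
  · exact ⟨0, le_rfl, fun x hx => by simp [closedBall_eq_empty.2 hR] at hx⟩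
  obtain ⟨K, hK⟩ := hG.contDiffOn.exists_lipschitzOnWith (by decide)
    (convex_closedBall xbar R) (isCompact_closedBall _ _)
  refine ⟨K, K.2, fun x hx => ?_⟩
  have := hK.dist_le_mul x hx xbar (mem_closedBall_self hR)
  rwa [Real.dist_eq, dist_eq_norm] at this

end AffineControl

namespace AffineControl

open Set Metric

/-! ### Regularity of the derived functions -/

section Smoothness

variable {n m : ℕ} {u : E n → ℝ} {σ₀ : E n → E n} {σ : Fin m → E n → E n}

lemma contDiff_fderiv_apply {k : WithTop ℕ∞} {F : E n → E n} (hu : ContDiff ℝ (k + 1) u)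
    (hF : ContDiff ℝ k F) : ContDiff ℝ k fun z => fderiv ℝ u z (F z) :=
  (hu.fderiv_right le_rfl).clm_apply hF

lemma contDiff_secondHamiltonian {k : WithTop ℕ∞} {F G : E n → E n}
    (hu : ContDiff ℝ (k + 1 + 1) u) (hF : ContDiff ℝ (k + 1) F) (hG : ContDiff ℝ k G) :
    ContDiff ℝ k (secondHamiltonian u G F) :=
  contDiff_fderiv_apply (contDiff_fderiv_apply hu hF) hG

lemma contDiff_affineField (hσ₀ : ContDiff ℝ 2 σ₀) (hσ : ∀ j, ContDiff ℝ 2 (σ j)) :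
    ContDiff ℝ 2 (Function.uncurry (affineField σ₀ σ)) := by
  have : Function.uncurry (affineField σ₀ σ) =
      fun z : E n × E m => σ₀ z.1 + ∑ j, z.2 j • σ j z.1 := rfl
  rw [this]
  fun_prop

end Smoothness

/-! ### Reaching the target with one switch -/

section Sufficiency

variable {n m : ℕ} {u : E n → ℝ} {σ₀ : E n → E n} {σ : Fin m → E n → E n} {xbar : E n}
  {target : Set (E n)}

/-- If switching from `a` to `b` decreases `u` at second order, the target is reached with this
switching in a time of the order of the square root of the distance. -/
lemma exists_reachesAt_of_switchRate_neg
    (hσ₀ : ContDiff ℝ 2 σ₀) (hσ : ∀ j, ContDiff ℝ 2 (σ j)) (hu : ContDiff ℝ 3 u)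
    (htarget : ∀ᶠ x in 𝓝 xbar, x ∈ target ↔ u x ≤ u xbar)
    (htan₀ : fderiv ℝ u xbar (σ₀ xbar) = 0) (htan : ∀ j, fderiv ℝ u xbar (σ j xbar) = 0)
    {a b : E m} (ha : a ∈ closedBall (0 : E m) 1) (hb : b ∈ closedBall (0 : E m) 1)
    (hneg : switchRate u σ₀ σ xbar a b < 0) :
    ∃ C > 0, ∀ᶠ x in 𝓝 xbar, ∃ α, IsPiecewiseConstantControl α ∧
      ReachesAt (affineField σ₀ σ) target α x (C * ‖x - xbar‖ ^ (1 / 2 : ℝ)) := by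
  have hf2 := contDiff_affineField hσ₀ hσ
  have hfc : Continuous (Function.uncurry (affineField σ₀ σ)) := hf2.continuous
  have hfa : ∀ c : E m, ContDiff ℝ 2 fun z => affineField σ₀ σ z c := fun c =>
    hf2.comp (contDiff_id.prodMk contDiff_const)
  set H : E m → E m → E n → ℝ := fun c d =>
    secondHamiltonian u (fun z => affineField σ₀ σ z c) (fun z => affineField σ₀ σ z d) with hH
  set p : E m → E n → ℝ := fun c z => fderiv ℝ u z (affineField σ₀ σ z c) with hp
  have hpC : ∀ c, ContDiff ℝ 1 (p c) := fun c =>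
    (contDiff_fderiv_apply (k := 2) hu (hfa c)).of_le (by norm_num)
  have hHC : ∀ c d, Continuous (H c d) := fun c d =>
    (contDiff_secondHamiltonian (k := 1) hu (hfa d) ((hfa c).of_le (by norm_num))).continuous
  have hu1 : ContDiff ℝ 1 u := hu.of_le (by norm_num)
  have hp0 : ∀ c, p c xbar = 0 := fun c => by simp [hp, affineField, htan₀, htan]
  -- The main term is `-4 * δ * t ^ 2`. The oscillation of the three Hamiltonians costs `2 * δ * t ^
  -- 2`, the terms linear in the distance another `δ * t ^ 2`.
  set δ : ℝ := -switchRate u σ₀ σ xbar a b / 8 with hδ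
  have hδ0 : 0 < δ := by rw [hδ]; linarith
  have hsum : H a a xbar + 2 * H a b xbar + H b b xbar = -8 * δ := by
    rw [hδ]; simp only [hH, switchRate]; ring
  -- a ball with almost constant second order terms
  have hnear : ∀ c d, ∀ᶠ z in 𝓝 xbar, H c d z ≤ H c d xbar + δ := fun c d =>
    ((hHC c d).tendsto xbar).eventually (Iic_mem_nhds (by linarith))
  obtain ⟨ρ, hρ, hball⟩ := (nhds_basis_closedBall.eventually_iff).1
    (htarget.and ((hnear a a).and ((hnear a b).and (hnear b b))))
  obtain ⟨M, hM⟩ := ((isCompact_closedBall xbar ρ).prod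
    (isCompact_closedBall (0 : E m) 1)).exists_bound_of_continuousOn hfc.continuousOn
  have hMc : ∀ c ∈ closedBall (0 : E m) 1, ∀ z ∈ closedBall xbar ρ,
      ‖affineField σ₀ σ z c‖ ≤ M := fun c hc z hz => hM (z, c) ⟨hz, hc⟩
  have hM0 : 0 ≤ M := (norm_nonneg _).trans (hMc a ha xbar (mem_closedBall_self hρ.le))
  obtain ⟨La, hLa0, hLa⟩ := exists_abs_sub_le (hpC a) xbar ρ
  obtain ⟨Lb, hLb0, hLb⟩ := exists_abs_sub_le (hpC b) xbar ρ
  obtain ⟨Lu, hLu0, hLu⟩ := exists_abs_sub_le hu1 xbar ρ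
  obtain ⟨ra, hra, εa, hεa, hexa⟩ :=
    exists_isTrajectory_const ((hfa a).of_le (by norm_num)) xbar
  obtain ⟨rb, hrb, εb, hεb, hexb⟩ :=
    exists_isTrajectory_const ((hfa b).of_le (by norm_num)) xbar
  -- With `t ^ 2 = k * ‖x - xbar‖` this makes `δ * t ^ 2` dominate all terms linear in the distance;
  -- the `+ 1` keeps `k` positive.
  set k : ℝ := (Lu + La + Lb) / δ + 1 with hk
  have hk0 : 0 < k := by positivity
  have hkδ : Lu + La + Lb ≤ k * δ := by
    rw [hk, add_mul, div_mul_cancel₀ _ hδ0.ne']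
    linarith
  refine ⟨2 * √k, by positivity, ?_⟩
  have hsmall : ∀ {φ : E n → ℝ} {c : ℝ}, Continuous φ → φ xbar < c → ∀ᶠ x in 𝓝 xbar, φ x < c :=
    fun hφ hc => (hφ.tendsto xbar).eventually (Iio_mem_nhds hc)
  filter_upwards [closedBall_mem_nhds xbar hra, closedBall_mem_nhds xbar hρ,
    hsmall (φ := fun x => √k * √‖x - xbar‖) (c := min 1 (min εa εb)) (by fun_prop)
      (by simp [hεa, hεb]),
    hsmall (φ := fun x => ‖x - xbar‖ + M * (√k * √‖x - xbar‖)) (c := rb) (by fun_prop)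
      (by simp [hrb]),
    hsmall (φ := fun x => ‖x - xbar‖ + M * (√k * √‖x - xbar‖) + M * (√k * √‖x - xbar‖))
      (c := ρ) (by fun_prop) (by simp [hρ])] with x hxa hxρ hx1 hx2 hx3
  set t : ℝ := √k * √‖x - xbar‖ with ht
  have ht0 : 0 ≤ t := by positivity
  have htsq : t ^ 2 = k * ‖x - xbar‖ := by
    rw [ht, mul_pow, Real.sq_sqrt hk0.le, Real.sq_sqrt (norm_nonneg _)]
  have hMt : 0 ≤ M * t := by positivity
  obtain ⟨ht1, hta, htb⟩ : t < 1 ∧ t < εa ∧ t < εb := by simpa using hx1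
  obtain ⟨y, hy⟩ := hexa x hxa t hta.le
  have hyin := hy.norm_sub_le hM0 (fun z hz _ => hMc a ha z hz) (by linarith : _ < ρ)
  have hyt : ‖y t - xbar‖ ≤ ‖x - xbar‖ + M * t := by
    have := (hyin t ⟨ht0, le_rfl⟩).1
    have := norm_sub_le_norm_sub_add_norm_sub (y t) x xbar
    linarith
  obtain ⟨y', hy'⟩ := hexb (y t) (by rw [mem_closedBall, dist_eq_norm]; linarith) t htb.le
  have hyin' := hy'.norm_sub_le hM0 (fun z hz _ => hMc b hb z hz) (by linarith : _ < ρ)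
  have hu2 := hy.sub_le_second ht0 hfc ha hu1 (hpC a) (M := H a a xbar + δ)
    fun s hs => (hball (hyin s hs).2).2.1
  have hu2' := hy'.sub_le_second ht0 hfc hb hu1 (hpC b) (M := H b b xbar + δ)
    fun s hs => (hball (hyin' s hs).2).2.2.2
  have hpb := hy.sub_le ht0 hfc ⟨measurable_const, fun _ => ha⟩ (hpC b) (M := H a b xbar + δ)
    fun s hs => (hball (hyin s (Ioo_subset_Icc_self hs)).2).2.2.1
  have hxLa := le_of_abs_le (hLa x hxρ)
  have hxLb := le_of_abs_le (hLb x hxρ)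
  have hxLu := le_of_abs_le (hLu x hxρ)
  rw [hp0, sub_zero] at hxLa hxLb
  have hfinal : u (y' t) ≤ u xbar := by
    have e1 : t * p a x ≤ La * ‖x - xbar‖ :=
      (mul_le_mul_of_nonneg_left hxLa ht0).trans
        (mul_le_of_le_one_left (by positivity) ht1.le)
    have e2 : t * p b x ≤ Lb * ‖x - xbar‖ :=
      (mul_le_mul_of_nonneg_left hxLb ht0).trans
        (mul_le_of_le_one_left (by positivity) ht1.le)
    have e3 : t * p b (y t) ≤ t * p b x + t ^ 2 * (H a b xbar + δ) := by
      have := mul_le_mul_of_nonneg_left hpb ht0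
      linarith
    have e4 : (Lu + La + Lb) * ‖x - xbar‖ ≤ δ * t ^ 2 := by
      rw [htsq]
      have := mul_le_mul_of_nonneg_right hkδ (norm_nonneg (x - xbar))
      linarith
    have e5 : t ^ 2 / 2 * (H a a xbar + δ) + t ^ 2 * (H a b xbar + δ) +
        t ^ 2 / 2 * (H b b xbar + δ) = -2 * (δ * t ^ 2) := by
      linear_combination t ^ 2 / 2 * hsum
    have e6 : 0 ≤ δ * t ^ 2 := by positivity
    simp only [hp] at e1 e2 e3
    linarith
  have htime : 2 * √k * ‖x - xbar‖ ^ (1 / 2 : ℝ) = t + t := by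
    rw [ht, Real.sqrt_eq_rpow ‖x - xbar‖]
    ring
  refine ⟨_, isPiecewiseConstantControl_ite ha hb t, ?_⟩
  rw [htime]
  -- The first branch occurs only for `t = 0`, where both arcs are a single point.
  have hend : (if t + t ≤ t then y (t + t) else y' (t + t - t)) = y' t := by
    split_ifs with hle
    · have h0 : t = 0 := by linarith
      have h1 := hy'.apply_zero ht0
      rw [h0] at h1 ⊢
      rw [h1, add_zero]
    · rw [add_sub_cancel_right]
  refine ⟨by linarith, _, hy.concat (hfa a).continuous (hfa b).continuous hy' ht0 ht0, ?_⟩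
  simp only [hend]
  exact (hball (hyin' t ⟨ht0, le_rfl⟩).2).1.2 hfinal

/-- The target is attained in small time if it is reached in a time controlled by a positive power
of the distance. -/
lemma isSTLA_of_reachesAt {f : E n → E m → E n} {U : Set (ℝ → E m)}
    (hU : ∀ a, IsPiecewiseConstantControl a → a ∈ U) {C s : ℝ} (hs : 0 < s)
    (h : ∀ᶠ x in 𝓝 xbar, ∃ α, IsPiecewiseConstantControl α ∧
      ReachesAt f target α x (C * ‖x - xbar‖ ^ s)) :
    IsSTLA f target U xbar := by
  intro t ht
  rw [mem_interior_iff_mem_nhds]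
  have hlim : Filter.Tendsto (fun x => C * ‖x - xbar‖ ^ s) (𝓝 xbar) (𝓝 0) := by
    have : Continuous fun x : E n => C * ‖x - xbar‖ ^ s :=
      continuous_const.mul ((by fun_prop : Continuous fun x : E n => ‖x - xbar‖).rpow_const
        fun _ => Or.inr hs.le)
    simpa [Real.zero_rpow hs.ne'] using this.tendsto xbar
  filter_upwards [h, hlim.eventually (Iio_mem_nhds ht)] with x ⟨α, hα, hr⟩ hx
  exact ⟨α, hU α hα, _, hx, hr⟩

lemma holderEstimate_of_reachesAt {f : E n → E m → E n} {U : Set (ℝ → E m)}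
    (hU : ∀ a, IsPiecewiseConstantControl a → a ∈ U) {C s s' : ℝ} (hC : 0 < C) (hs : 0 < s)
    (hss : s ≤ s')
    (h : ∀ᶠ x in 𝓝 xbar, ∃ α, IsPiecewiseConstantControl α ∧
      ReachesAt f target α x (C * ‖x - xbar‖ ^ s')) :
    HolderEstimate f target U xbar s := by
  -- At distances at most `1` the smaller exponent gives the weaker bound.
  obtain ⟨r, hr, hball⟩ := nhds_basis_closedBall.eventually_iff.1
    (h.and (closedBall_mem_nhds xbar one_pos))
  refine ⟨C, r, hC, hr, fun x hx => ?_⟩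
  obtain ⟨⟨α, hα, hreach⟩, h1⟩ := hball hx
  rw [dist_eq_norm] at h1
  refine (iInf₂_le α (hU α hα)).trans ((iInf₂_le _ hreach).trans ?_)
  gcongr ENNReal.ofReal (C * ?_)
  exact Real.rpow_le_rpow_of_exponent_ge' (norm_nonneg _) h1 hs.le hss

end Sufficiency

end AffineControl

namespace AffineControl

open Set MeasureTheory Metric

/-! ### Second order expansion in the primitive of the control -/

section Expansion

variable {n m : ℕ} {u : E n → ℝ} {xbar : E n}

/-- Symmetry of `Q` is what makes the form `b · Q B` exact; otherwise its integral would depend on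
the path of `B` and not only on its endpoint. -/
lemma hasDerivAt_half_quadratic {ι : Type*} [Fintype ι] {Q : ι → ι → ℝ}
    (hQ : ∀ i j, Q i j = Q j i) {B : ℝ → ι → ℝ} {b : ι → ℝ} {s : ℝ}
    (hB : HasDerivAt B b s) :
    HasDerivAt (fun s => 1 / 2 * ∑ i, ∑ j, Q i j * (B s i * B s j))
      (∑ i, b i * ∑ j, Q i j * B s j) s := by
  have hBi : ∀ i, HasDerivAt (fun s => B s i) (b i) s := hasDerivAt_pi.1 hB
  have h1 := (HasDerivAt.fun_sum (u := Finset.univ) fun i _ =>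
    HasDerivAt.fun_sum (u := Finset.univ) fun j _ =>
      ((hBi i).mul (hBi j)).const_mul (Q i j)).const_mul (1 / 2)
  refine h1.congr_deriv ?_
  have h2 : ∑ i, ∑ j, Q i j * (B s i * b j) = ∑ i, ∑ j, Q i j * (b i * B s j) := by
    rw [Finset.sum_comm]
    exact Finset.sum_congr rfl fun i _ => Finset.sum_congr rfl fun j _ => by rw [hQ j i]; ring
  simp only [mul_add, Finset.sum_add_distrib]
  rw [h2, ← mul_add, ← two_mul, ← mul_assoc]
  norm_num [Finset.mul_sum]
  exact Finset.sum_congr rfl fun i _ => Finset.sum_congr rfl fun j _ => by ring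

/-- Second order expansion of `u` along the trajectories of a system linear in the controls `b`,
when the fields are tangent at `xbar` and the second order Hamiltonians are symmetric: the second
order term depends on the primitive `B` of the controls only. -/
lemma exists_expansion_bound {ι : Type*} [Fintype ι] {F : ι → E n → E n}
    (hu : ContDiff ℝ 3 u) (hF : ∀ i, ContDiff ℝ 2 (F i))
    (hp0 : ∀ i, fderiv ℝ u xbar (F i xbar) = 0)
    (hsymm : ∀ i j, secondHamiltonian u (F i) (F j) xbar = secondHamiltonian u (F j) (F i) xbar)
    (R : ℝ) {M : ℝ} (hM : 0 ≤ M) :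
    ∃ C, 0 ≤ C ∧ ∀ (x : E n) (t : ℝ) (y : ℝ → E n) (b B : ℝ → ι → ℝ) (K : NNReal),
      0 ≤ t → t ≤ 1 → LipschitzOnWith K (fun s => (y s, B s)) (Icc 0 t) →
      (∀ s ∈ Icc 0 t, ‖y s - x‖ ≤ M * s ∧ y s ∈ closedBall xbar R) → B 0 = 0 →
      (∀ s i, |b s i| ≤ 1) →
      (∀ᵐ s, s ∈ Ioo 0 t → HasDerivAt y (∑ i, b s i • F i (y s)) s ∧ HasDerivAt B (b s) s) →
      |u (y t) - u x - 1 / 2 * ∑ i, ∑ j, secondHamiltonian u (F j) (F i) xbar * (B t i * B t j)|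
        ≤ C * (‖x - xbar‖ + t ^ 2) * t := by
  set p : ι → E n → ℝ := fun i z => fderiv ℝ u z (F i z) with hp
  have hpC : ∀ i, ContDiff ℝ 1 (p i) := fun i =>
    (contDiff_fderiv_apply (k := 2) hu (hF i)).of_le (by norm_num)
  have hqC : ∀ i j, ContDiff ℝ 1 (secondHamiltonian u (F j) (F i)) := fun i j =>
    contDiff_secondHamiltonian (k := 1) hu (hF i) ((hF j).of_le (by norm_num))
  set Q : ι → ι → ℝ := fun i j => secondHamiltonian u (F j) (F i) xbar with hQ
  have hQs : ∀ i j, Q i j = Q j i := fun i j => hsymm j i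
  choose ℓ hℓ0 hℓ using fun i => exists_abs_sub_le (hpC i) xbar R
  choose L hL0 hL using fun i j => exists_abs_sub_le (hqC i j) xbar R
  set ℓ' := ∑ i, ℓ i with hℓ'
  set L' := ∑ i, ∑ j, L i j with hL'
  have hℓle : ∀ i, ℓ i ≤ ℓ' := fun i =>
    Finset.single_le_sum (fun i _ => hℓ0 i) (Finset.mem_univ i)
  have hLle : ∀ i, ∑ j, L i j ≤ L' := fun i =>
    Finset.single_le_sum (f := fun i => ∑ j, L i j)
      (fun i _ => Finset.sum_nonneg fun j _ => hL0 i j) (Finset.mem_univ i)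
  have hℓ'0 : 0 ≤ ℓ' := Finset.sum_nonneg fun i _ => hℓ0 i
  have hL'0 : 0 ≤ L' := Finset.sum_nonneg fun i _ => Finset.sum_nonneg fun j _ => hL0 i j
  set D := ℓ' + L' + L' * M with hD
  have hD0 : 0 ≤ D := by positivity
  -- The constant does not involve `K`, which serves only to get absolute continuity.
  refine ⟨Fintype.card ι * D, by positivity, ?_⟩
  intro x t y b B K ht ht1 hK hy hB0 hb hd
  set ε := ‖x - xbar‖ with hε
  have hε0 : 0 ≤ ε := norm_nonneg _
  have hy0 : y 0 = x := by
    have := (hy 0 ⟨le_rfl, ht⟩).1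
    rw [mul_zero, norm_le_zero_iff] at this
    exact sub_eq_zero.1 this
  have hxR : x ∈ closedBall xbar R := hy0 ▸ (hy 0 ⟨le_rfl, ht⟩).2
  -- first order remainders
  have hR : ∀ i, ∀ s ∈ Icc 0 t, |p i (y s) - ∑ j, Q i j * B s j| ≤ D * (ε + t ^ 2) := by
    intro i s hs
    have hG : ContDiff ℝ 1 fun z : E n × (ι → ℝ) => p i z.1 - ∑ j, Q i j * z.2 j := by
      have := hpC i
      fun_prop
    have h1 := abs_sub_le_of_ae_hasDerivAt hs.1 (hK.mono (Icc_subset_Icc_right hs.2)) hG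
      (M := L' * (ε + M * s)) (by
        filter_upwards [hd] with r hr hmem
        obtain ⟨h1, h2⟩ := hr ⟨hmem.1, hmem.2.trans_le hs.2⟩
        have hBi : ∀ j, HasDerivAt (fun s => B s j) (b r j) r := hasDerivAt_pi.1 h2
        refine ⟨_, (((hpC i).differentiable (by norm_num)).differentiableAt.hasFDerivAt.comp_hasDerivAt
          r h1).sub (HasDerivAt.fun_sum (u := Finset.univ) fun j _ =>
            (hBi j).const_mul (Q i j)), ?_⟩
        have hrt : r ∈ Icc 0 t := ⟨hmem.1.le, hmem.2.le.trans hs.2⟩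
        have hdist : ‖y r - xbar‖ ≤ ε + M * s := by
          have h3 := norm_sub_le_norm_sub_add_norm_sub (y r) x xbar
          have h4 := (hy r hrt).1
          have h5 : M * r ≤ M * s := mul_le_mul_of_nonneg_left hmem.2.le hM
          linarith
        have heq : fderiv ℝ (p i) (y r) (∑ j, b r j • F j (y r)) - ∑ j, Q i j * b r j =
            ∑ j, b r j * (secondHamiltonian u (F j) (F i) (y r) - Q i j) := by
          rw [map_sum, ← Finset.sum_sub_distrib]
          refine Finset.sum_congr rfl fun j _ => ?_
          rw [map_smul, smul_eq_mul, mul_sub, mul_comm (Q i j)]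
          rfl
        rw [heq]
        calc |∑ j, b r j * (secondHamiltonian u (F j) (F i) (y r) - Q i j)|
            ≤ ∑ j, |b r j * (secondHamiltonian u (F j) (F i) (y r) - Q i j)| :=
              Finset.abs_sum_le_sum_abs _ _
          _ ≤ ∑ j, L i j * ‖y r - xbar‖ := by
              refine Finset.sum_le_sum fun j _ => ?_
              rw [abs_mul]
              exact (mul_le_of_le_one_left (abs_nonneg _) (hb r j)).trans
                (hL i j _ (hy r hrt).2)
          _ ≤ L' * (ε + M * s) := by
              rw [← Finset.sum_mul]
              exact mul_le_mul (hLle i) hdist (norm_nonneg _) hL'0)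
    simp only [hy0, hB0, Pi.zero_apply, mul_zero, Finset.sum_const_zero, sub_zero] at h1
    have h2 : |p i x| ≤ ℓ' * ε := by
      have h3 := hℓ i x hxR
      rw [show p i xbar = 0 from hp0 i, sub_zero] at h3
      exact h3.trans (mul_le_mul_of_nonneg_right (hℓle i) hε0)
    have h3 := abs_sub_abs_le_abs_sub (p i (y s) - ∑ j, Q i j * B s j) (p i x)
    have h4 : L' * (ε + M * s) * s ≤ L' * ε + L' * M * t ^ 2 := by
      have h5 : L' * ε * s ≤ L' * ε :=
        mul_le_of_le_one_right (by positivity) (hs.2.trans ht1)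
      have h6 : s ^ 2 ≤ t ^ 2 := pow_le_pow_left₀ hs.1 hs.2 2
      have h7 : L' * M * s ^ 2 ≤ L' * M * t ^ 2 := by gcongr
      linarith
    have h5 : D * (ε + t ^ 2) = (ℓ' * ε + (L' * ε + L' * M * t ^ 2)) +
        (L' * M * ε + ℓ' * t ^ 2 + L' * t ^ 2) := by rw [hD]; ring
    have h6 : 0 ≤ L' * M * ε + ℓ' * t ^ 2 + L' * t ^ 2 := by positivity
    linarith
  have hu1 : ContDiff ℝ 1 u := hu.of_le (by norm_num)
  have hG : ContDiff ℝ 1 fun z : E n × (ι → ℝ) =>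
      u z.1 - 1 / 2 * ∑ i, ∑ j, Q i j * (z.2 i * z.2 j) := by fun_prop
  have h1 := abs_sub_le_of_ae_hasDerivAt ht hK hG
    (M := Fintype.card ι * (D * (ε + t ^ 2))) (by
      filter_upwards [hd] with r hr hmem
      obtain ⟨h1, h2⟩ := hr hmem
      refine ⟨_, ((hu1.differentiable (by norm_num)).differentiableAt.hasFDerivAt.comp_hasDerivAt
          r h1).sub (hasDerivAt_half_quadratic hQs h2), ?_⟩
      have heq : fderiv ℝ u (y r) (∑ j, b r j • F j (y r)) - ∑ i, b r i * ∑ j, Q i j * B r j =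
          ∑ i, b r i * (p i (y r) - ∑ j, Q i j * B r j) := by
        rw [map_sum, ← Finset.sum_sub_distrib]
        refine Finset.sum_congr rfl fun j _ => ?_
        rw [map_smul, smul_eq_mul, mul_sub]
      rw [heq]
      calc |∑ i, b r i * (p i (y r) - ∑ j, Q i j * B r j)|
          ≤ ∑ i, |b r i * (p i (y r) - ∑ j, Q i j * B r j)| := Finset.abs_sum_le_sum_abs _ _
        _ ≤ ∑ _i : ι, D * (ε + t ^ 2) := by
            refine Finset.sum_le_sum fun i _ => ?_
            rw [abs_mul]
            exact (mul_le_of_le_one_left (abs_nonneg _) (hb r i)).trans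
              (hR i r (Ioo_subset_Icc_self hmem))
        _ = Fintype.card ι * (D * (ε + t ^ 2)) := by simp)
  simp only [hy0, hB0, Pi.zero_apply, mul_zero, Finset.sum_const_zero, sub_zero] at h1
  rw [sub_right_comm, mul_assoc (Fintype.card ι : ℝ) D]
  exact h1

end Expansion

/-! ### Lower bound on `u` and the critical exponent `1/3` -/

section Necessity

variable {n m : ℕ} {u : E n → ℝ} {σ₀ : E n → E n} {σ : Fin m → E n → E n} {xbar : E n}
  {target : Set (E n)}

/-- If neither condition holds, `u` decreases at most at third order along trajectories. -/
lemma exists_lower_bound (hσ₀ : ContDiff ℝ 2 σ₀) (hσ : ∀ j, ContDiff ℝ 2 (σ j))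
    (hu : ContDiff ℝ 3 u)
    (htan₀ : fderiv ℝ u xbar (σ₀ xbar) = 0) (htan : ∀ j, fderiv ℝ u xbar (σ j xbar) = 0)
    (hsw : ¬ SwitchCondition u σ₀ σ xbar) (hsf : ¬ SingleFieldCondition u σ₀ σ xbar)
    {ρ : ℝ} (hρ : 0 < ρ) :
    ∃ C, 0 ≤ C ∧ ∃ M, 0 ≤ M ∧ ∀ (x : E n) (t : ℝ) (a : ℝ → E m) (y : ℝ → E n),
      IsMeasurableControl a → IsTrajectory (affineField σ₀ σ) a x t y → 0 ≤ t → t ≤ 1 →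
      ‖x - xbar‖ + M * t < ρ →
      y t ∈ closedBall xbar ρ ∧ -(C * (‖x - xbar‖ + t ^ 2) * t) ≤ u (y t) - u x := by
  have hf2 := contDiff_affineField hσ₀ hσ
  have hfc : Continuous (Function.uncurry (affineField σ₀ σ)) := hf2.continuous
  have hu2 : ContDiff ℝ 2 u := hu.of_le (by norm_num)
  obtain ⟨M, hM⟩ := ((isCompact_closedBall xbar ρ).prod
    (isCompact_closedBall (0 : E m) 1)).exists_bound_of_continuousOn hfc.continuousOn
  have hM0 : 0 ≤ M := (norm_nonneg _).trans
    (hM (xbar, 0) ⟨mem_closedBall_self hρ.le, mem_closedBall_self zero_le_one⟩)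
  have hF : ∀ i, ContDiff ℝ 2 (extField σ₀ σ i) := contDiff_extField hσ₀ hσ
  obtain ⟨C, hC0, hC⟩ := exists_expansion_bound (xbar := xbar) hu hF
    (by rintro (_ | j); exacts [htan₀, htan j])
    (secondHamiltonian_extField_comm hu2 hσ₀ hσ hsw) ρ hM0
  refine ⟨C, hC0, M, hM0, fun x t a y ha hy ht ht1 hsmall => ?_⟩
  have hin := hy.norm_sub_le hM0 (fun z hz s => hM (z, a s) ⟨hz, ha.2 s⟩) hsmall
  refine ⟨(hin t ⟨ht, le_rfl⟩).2, ?_⟩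
  obtain ⟨⟨K, hK⟩, hd⟩ := hy.regularity ht hfc ha
  set b : ℝ → Option (Fin m) → ℝ := fun s => extControl (a s) with hb
  have hb1 : ∀ s i, |b s i| ≤ 1 := fun s i => abs_extControl_le (ha.2 s) i
  set A : ℝ → E m := fun s => ∫ r in (0 : ℝ)..s, a r with hA
  have hai : IntervalIntegrable a volume 0 t :=
    intervalIntegrable_of_bound ht ha.1.aestronglyMeasurable fun s _ =>
      mem_closedBall_zero_iff.1 (ha.2 s)
  have hAeq : ∀ s ∈ Icc 0 t, A s = 0 + ∫ r in (0 : ℝ)..s, a r := fun s _ => (zero_add _).symm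
  have hAl : LipschitzOnWith 1 A (Icc 0 t) :=
    lipschitzOnWith_of_eq_integral ht hai
      (fun s _ => by simpa using mem_closedBall_zero_iff.1 (ha.2 s)) hAeq
  have hAd := ae_hasDerivAt_of_eq_integral ht hai hAeq
  -- The drift has coefficient `1`, so its primitive is time itself.
  set B : ℝ → Option (Fin m) → ℝ := fun s i => i.elim s (A s) with hB
  have hBl : LipschitzOnWith 1 B (Icc 0 t) := by
    refine LipschitzOnWith.of_dist_le_mul fun s hs r hr => ?_
    refine (dist_pi_le_iff (by positivity)).2 ?_
    rintro (_ | j)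
    · simp [hB]
    · refine le_trans ?_ (hAl.dist_le_mul s hs r hr)
      rw [dist_eq_norm, dist_eq_norm]
      exact PiLp.norm_apply_le (A s - A r) j
  have hexp := hC x t y b B (max K 1) ht ht1 (hK.prodMk hBl) hin
    (by ext (_ | j) <;> simp [hB, hA]) hb1 (by
      filter_upwards [hd, hAd] with s h1 h2 hmem
      refine ⟨?_, hasDerivAt_pi.2 ?_⟩
      · rw [← affineField_eq_sum]
        exact h1 hmem
      · rintro (_ | j)
        · exact hasDerivAt_id s
        · exact (EuclideanSpace.proj (𝕜 := ℝ) j).hasFDerivAt.comp_hasDerivAt s (h2 hmem))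
  have hquad : 0 ≤ ∑ i, ∑ j, secondHamiltonian u (extField σ₀ σ j) (extField σ₀ σ i) xbar *
      (B t i * B t j) := by
    rcases ht.eq_or_lt with rfl | htpos
    · have : B 0 = 0 := by ext (_ | j) <;> simp [hB, hA]
      simp [this]
    -- The mean of the control is an admissible constant by convexity of the ball, and the form at
    -- `B t` is `t ^ 2` times its Hamiltonian.
    · set c : E m := t⁻¹ • A t with hc
      have hcball : c ∈ closedBall (0 : E m) 1 := by
        have := intervalIntegral.norm_integral_le_of_norm_le_const (a := 0) (b := t) (C := 1)
          (f := a) fun s _ => mem_closedBall_zero_iff.1 (ha.2 s)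
        rw [mem_closedBall_zero_iff, hc, norm_smul, Real.norm_eq_abs,
          abs_of_pos (inv_pos.2 htpos), inv_mul_le_iff₀ htpos]
        simpa [abs_of_pos htpos] using this
      have hnn : 0 ≤ secondHamiltonian u (fun x => affineField σ₀ σ x c)
          (fun x => affineField σ₀ σ x c) xbar := by
        by_contra hlt
        exact hsf ⟨c, hcball, not_le.1 hlt⟩
      simp only [affineField_eq_sum] at hnn
      rw [secondHamiltonian_sum hu2 fun i => (hF i).of_le (by norm_num)] at hnn
      have hBc : ∀ i, B t i = t * extControl c i := by
        rintro (_ | j)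
        · simp [hB, extControl]
        · simp [hB, extControl, hc, htpos.ne']
      have : ∑ i, ∑ j, secondHamiltonian u (extField σ₀ σ j) (extField σ₀ σ i) xbar *
          (B t i * B t j) = t ^ 2 * ∑ i, ∑ j, extControl c i * extControl c j *
            secondHamiltonian u (extField σ₀ σ i) (extField σ₀ σ j) xbar := by
        rw [Finset.sum_comm]
        simp only [Finset.mul_sum, hBc]
        exact Finset.sum_congr rfl fun i _ => Finset.sum_congr rfl fun j _ => by ring
      rw [this]
      positivity
  have := (abs_le.1 hexp).1
  linarith

lemma switchCondition_or_singleFieldCondition_of_holderEstimate {U : Set (ℝ → E m)}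
    (hσ₀ : ContDiff ℝ 2 σ₀) (hσ : ∀ j, ContDiff ℝ 2 (σ j)) (hu : ContDiff ℝ 3 u)
    (htarget : ∀ᶠ x in 𝓝 xbar, x ∈ target ↔ u x ≤ u xbar)
    (hU : ∀ a ∈ U, IsMeasurableControl a) (hgrad : fderiv ℝ u xbar ≠ 0)
    (htan₀ : fderiv ℝ u xbar (σ₀ xbar) = 0) (htan : ∀ j, fderiv ℝ u xbar (σ j xbar) = 0)
    {s : ℝ} (hs : 1 / 3 < s) (h : HolderEstimate (affineField σ₀ σ) target U xbar s) :
    SwitchCondition u σ₀ σ xbar ∨ SingleFieldCondition u σ₀ σ xbar := by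
  by_contra hcon
  rw [not_or] at hcon
  obtain ⟨ρ, hρ, hball⟩ := nhds_basis_closedBall.eventually_iff.1 htarget
  obtain ⟨C₁, hC₁, M, hM, hlow⟩ :=
    exists_lower_bound hσ₀ hσ hu htan₀ htan hcon.1 hcon.2 hρ
  obtain ⟨C, r, hC, hr, hT⟩ := h
  obtain ⟨v, hv⟩ : ∃ v, fderiv ℝ u xbar v = 1 := by
    obtain ⟨w, hw⟩ := DFunLike.ne_iff.1 hgrad
    exact ⟨(fderiv ℝ u xbar w)⁻¹ • w, by
      rw [map_smul, smul_eq_mul, inv_mul_cancel₀ (by simpa using hw)]⟩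
  have hv0 : 0 < ‖v‖ := norm_pos_iff.2 fun h => by simp [h] at hv
  have hs0 : 0 < s := by linarith
  -- the times allowed by the estimate along the ray `xbar + ε v`
  set τ : ℝ → ℝ := fun ε => 2 * C * (ε * ‖v‖) ^ s with hτ
  have hτlim : Filter.Tendsto τ (𝓝[>] 0) (𝓝 0) := by
    have : Continuous τ := continuous_const.mul
      ((by fun_prop : Continuous fun ε : ℝ => ε * ‖v‖).rpow_const fun _ => Or.inr hs0.le)
    simpa [hτ, Real.zero_rpow hs0.ne'] using (this.tendsto 0).mono_left nhdsWithin_le_nhds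
  have hεlim : Filter.Tendsto (fun ε : ℝ => ε) (𝓝[>] 0) (𝓝 0) :=
    (continuous_id.tendsto 0).mono_left nhdsWithin_le_nhds
  -- Here `s > 1/3` enters: the cube of the allowed time is `ε` times this vanishing power.
  have hpow : Filter.Tendsto (fun ε : ℝ => ε ^ (3 * s - 1)) (𝓝[>] 0) (𝓝 0) := by
    have : Continuous fun ε : ℝ => ε ^ (3 * s - 1) :=
      continuous_id.rpow_const fun _ => Or.inr (by linarith)
    simpa [Real.zero_rpow (by linarith : 3 * s - 1 ≠ 0)] using
      (this.tendsto 0).mono_left nhdsWithin_le_nhds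
  have hslope : ∀ᶠ ε in 𝓝[>] (0 : ℝ), ε / 2 < u (xbar + ε • v) - u xbar := by
    have hd : HasDerivAt (fun ε : ℝ => u (xbar + ε • v)) 1 0 := by
      have h1 : HasDerivAt (fun ε : ℝ => xbar + ε • v) v 0 := by
        simpa using ((hasDerivAt_id (0 : ℝ)).smul_const v).const_add xbar
      have h2 : HasFDerivAt u (fderiv ℝ u xbar) (xbar + (0 : ℝ) • v) := by
        simpa using (hu.differentiable (by norm_num)).differentiableAt.hasFDerivAt
      rw [← hv]
      exact h2.comp_hasDerivAt 0 h1
    have := (hd.tendsto_slope.mono_left (nhdsWithin_mono 0 fun ε (hε : 0 < ε) => hε.ne')).eventually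
      (Ioi_mem_nhds (by norm_num : (1 / 2 : ℝ) < 1))
    filter_upwards [this, self_mem_nhdsWithin] with ε h1 (h2 : 0 < ε)
    simp only [slope_def_field, sub_zero, zero_smul, add_zero] at h1
    rw [lt_div_iff₀ h2] at h1
    linarith
  have hlim1 : Filter.Tendsto (fun ε => C₁ * ‖v‖ * τ ε + C₁ * (2 * C * ‖v‖ ^ s) ^ 3 *
      ε ^ (3 * s - 1)) (𝓝[>] 0) (𝓝 0) := by
    simpa using (hτlim.const_mul (C₁ * ‖v‖)).add (hpow.const_mul (C₁ * (2 * C * ‖v‖ ^ s) ^ 3))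
  have hlim2 : Filter.Tendsto (fun ε => ε * ‖v‖ + M * τ ε) (𝓝[>] 0) (𝓝 0) := by
    simpa using (hεlim.mul_const ‖v‖).add (hτlim.const_mul M)
  have hlim3 : Filter.Tendsto (fun ε => ε * ‖v‖) (𝓝[>] 0) (𝓝 0) := by
    simpa using hεlim.mul_const ‖v‖
  obtain ⟨ε, h1, h2, h3, h4, h5, hε⟩ := (hslope.and
    ((hlim1.eventually (Iio_mem_nhds (by norm_num : (0 : ℝ) < 1 / 2))).and
    ((hlim2.eventually (Iio_mem_nhds hρ)).and
    ((hlim3.eventually (Iio_mem_nhds hr)).and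
    ((hτlim.eventually (Iio_mem_nhds one_pos)).and self_mem_nhdsWithin))))).exists
  have hε : 0 < ε := hε
  set x := xbar + ε • v with hx
  have hnorm : ‖x - xbar‖ = ε * ‖v‖ := by
    rw [hx, add_sub_cancel_left, norm_smul, Real.norm_eq_abs, abs_of_pos hε]
  have hτ0 : 0 < (ε * ‖v‖) ^ s := Real.rpow_pos_of_pos (by positivity) s
  -- The factor `2` in `τ` gives strictness, so that some admissible control reaches the target
  -- before `τ ε` even if the infimum is not attained.
  have hlt : minTime (affineField σ₀ σ) target U x < ENNReal.ofReal (τ ε) := by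
    refine (hT x (by rw [mem_closedBall, dist_eq_norm, hnorm]; exact h4.le)).trans_lt ?_
    rw [hnorm, ENNReal.ofReal_lt_ofReal_iff (by positivity)]
    have := mul_pos hC hτ0
    simp only [hτ]
    linarith
  simp only [minTime, hittingTime, iInf_lt_iff] at hlt
  obtain ⟨a, haU, t, ⟨ht, y, hy, hyt⟩, hlt⟩ := hlt
  have htτ : t < τ ε := (ENNReal.ofReal_lt_ofReal_iff (by positivity)).1 hlt
  have hMt : M * t ≤ M * τ ε := by gcongr
  obtain ⟨hyball, hlower⟩ := hlow x t a y (hU a haU) hy ht (htτ.le.trans h5.le)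
    (by rw [hnorm]; linarith)
  have hle := (hball hyball).1 hyt
  rw [hnorm] at hlower
  have hmono : C₁ * (ε * ‖v‖ + t ^ 2) * t ≤ C₁ * (ε * ‖v‖ + τ ε ^ 2) * τ ε := by gcongr
  have hcube : τ ε ^ 3 = (2 * C * ‖v‖ ^ s) ^ 3 * ε ^ (3 * s - 1) * ε := by
    have e1 : ε ^ (3 * s - 1) * ε = (ε ^ s) ^ 3 := by
      rw [← Real.rpow_add_one hε.ne', ← Real.rpow_mul_natCast hε.le]
      congr 1
      push_cast
      ring
    rw [mul_assoc, e1, hτ]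
    simp only
    rw [Real.mul_rpow hε.le hv0.le]
    ring
  have hfin : C₁ * (ε * ‖v‖ + τ ε ^ 2) * τ ε = (C₁ * ‖v‖ * τ ε + C₁ * (2 * C * ‖v‖ ^ s) ^ 3 *
      ε ^ (3 * s - 1)) * ε := by
    linear_combination C₁ * hcube
  have := mul_lt_mul_of_pos_right h2 hε
  linarith

end Necessity

end AffineControl

/-! ### The equivalence -/

theorem mainTheorem6 {n m : ℕ}
    (σ₀ : AffineControl.E n → AffineControl.E n)
    (σ : Fin m → AffineControl.E n → AffineControl.E n)
    (u : AffineControl.E n → ℝ) (xbar : AffineControl.E n)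
    (target : Set (AffineControl.E n))
    (U : Set (ℝ → AffineControl.E m))
    (hσ₀ : ContDiff ℝ 2 σ₀) (hσ : ∀ j, ContDiff ℝ 2 (σ j)) (hu : ContDiff ℝ 3 u)
    -- the target is locally the sublevel set of `u` at `xbar`
    (htarget : ∀ᶠ x in 𝓝 xbar, x ∈ target ↔ u x ≤ u xbar)
    -- the class of admissible controls (piecewise constant, piecewise continuous, measurable, ...)
    (hUpc : ∀ a, AffineControl.IsPiecewiseConstantControl a → a ∈ U)
    (hUmeas : ∀ a ∈ U, AffineControl.IsMeasurableControl a)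
    (hgrad : fderiv ℝ u xbar ≠ 0)
    -- all available vector fields are tangent at `xbar`
    (htan₀ : fderiv ℝ u xbar (σ₀ xbar) = 0) (htan : ∀ j, fderiv ℝ u xbar (σ j xbar) = 0)
    -- the request on the drift
    (hdrift : AffineControl.secondHamiltonian u σ₀ σ₀ xbar ≤ 0) :
    (∀ s : ℝ, 1 / 3 < s → s ≤ 1 / 2 →
      (AffineControl.HolderEstimate (AffineControl.affineField σ₀ σ) target U xbar s ↔
        AffineControl.SwitchCondition u σ₀ σ xbar ∨
          AffineControl.SingleFieldCondition u σ₀ σ xbar)) ∧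
    (AffineControl.SwitchCondition u σ₀ σ xbar ∨
        AffineControl.SingleFieldCondition u σ₀ σ xbar →
      AffineControl.IsSTLA (AffineControl.affineField σ₀ σ) target U xbar ∧
        AffineControl.HolderEstimate (AffineControl.affineField σ₀ σ) target U xbar (1 / 2)) := by
  have hdir : AffineControl.SwitchCondition u σ₀ σ xbar ∨
      AffineControl.SingleFieldCondition u σ₀ σ xbar →
      ∃ C > 0, ∀ᶠ x in 𝓝 xbar, ∃ α, AffineControl.IsPiecewiseConstantControl α ∧
        AffineControl.ReachesAt (AffineControl.affineField σ₀ σ) target α x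
          (C * ‖x - xbar‖ ^ (1 / 2 : ℝ)) := by
    intro h
    obtain ⟨a, ha, b, hb, hneg⟩ := AffineControl.exists_switchRate_neg (hu.of_le (by norm_num))
      hσ₀ hσ hdrift h
    exact AffineControl.exists_reachesAt_of_switchRate_neg hσ₀ hσ hu htarget htan₀ htan ha hb hneg
  refine ⟨fun s hs hs' => ⟨fun h => ?_, fun h => ?_⟩, fun h => ?_⟩
  · exact AffineControl.switchCondition_or_singleFieldCondition_of_holderEstimate hσ₀ hσ hu
      htarget hUmeas hgrad htan₀ htan hs h
  · obtain ⟨C, hC, hreach⟩ := hdir h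
    exact AffineControl.holderEstimate_of_reachesAt hUpc hC (by linarith) hs' hreach
  · obtain ⟨C, hC, hreach⟩ := hdir h
    exact ⟨AffineControl.isSTLA_of_reachesAt hUpc (by norm_num) hreach,
      AffineControl.holderEstimate_of_reachesAt hUpc hC (by norm_num) le_rfl hreach⟩
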